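/- Let $n\ge 1$. Write $|x|$ for the Euclidean norm on $\mathbb R^n$, $\|M\|$ for the induced matrix norm, $\alpha(M)=\max\{\mathrm{Re}\,z:\ z\in\mathbb C,\ \det(zI-M)=0\}$ for the spectral abscissa of $M\in\mathbb R^{n\times n}$, and $f_{\rm ramp}(s)=\max\{s,0\}$. Let $A:[0,\infty)\to\mathbb R^{n\times n}$ and $g:[0,\infty)\times\mathbb R^n\to\mathbb R^n$ satisfy the following. (1) There are $L>0$ and $\alpha_{\max}\in\mathbb R$ with $\|A(t)\|\le L$ and $\alpha(A(t))\le\alpha_{\max}$ for all $t\ge 0$. (2) $A$ is càdlàg; every bounded interval contains only finitely many of its jump times $\{t>0: A(t)\ne A(t^-)\}$; and for all $0\le a<b$ such that $(a,b)$ contains no jump time, $t\mapsto A(t)$ and $t\mapsto\alpha(A(t))$ are absolutely continuous on $(a,b)$. (3) $g(\cdot,x)$ is locally Lebesgue integrable on $[0,\infty)$ for each $x$, $g(t,\cdot)$ is locally Lipschitz for each $t$, and $|g(t,x)|\le\gamma(t)|x|+\delta(t)$ for all $t\ge0$, $x\in\mathbb R^n$, with continuous functions $\gamma,\delta:[0,\infty)\to[0,\infty)$.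 Let $0<\beta<\kappa$ and, for a matrix $M$, put $\varphi_\kappa(M)=f_{\rm ramp}(\alpha(M)+\kappa)$ and $\tilde M=M-\varphi_\kappa(M)I$; put $\tilde A(t)=A(t)-\varphi_\kappa(A(t))I$. Then there is a constant $c>0$, depending only on $n,L,\alpha_{\max},\kappa,\beta$, such that $\|e^{s\tilde M}\|\le c\,e^{-\beta s}$ for all $s\ge0$ and all $M\in\mathbb R^{n\times n}$ with $\|M\|\le L$ and $\alpha(M)\le\alpha_{\max}$. Moreover, let $c>0$ be any constant with $$\|e^{s\tilde A(t)}\|\le c\,e^{-\beta s}\qquad\text{for all } s,t\ge 0,$$ and set $$c_1=\frac{1}{2\big(L+f_{\rm ramp}(\alpha_{\max}+\kappa)\big)},\qquad c_2=\frac{c^2}{2\beta}.$$ Suppose that there are $\lambda<\frac{c_1}{2c_2}$ and $\varrho>0$ such that for all $t_b\ge t_a\ge0$ $$c_1\int_{t_a}^{t_b}\varphi_\kappa(A(\tau))\,d\tau+c_2\int_{t_a}^{t_b}\gamma(\tau)\,d\tau+c_2^2\int_{t_a}^{t_b}\|d\tilde A\|\le\lambda(t_b-t_a)+\varrho,$$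 where $\int_{t_a}^{t_b}\|d\tilde A\|$ is the total variation of $\tilde A$ on $[t_a,t_b]$, that is, the supremum of $\sum_i\|\tilde A(t_{i+1})-\tilde A(t_i)\|$ over all partitions $t_a=t_0<t_1<\dots<t_m=t_b$. Then there are $k_1,k_2,k_3>0$, independent of the initial data and of the solution, such that every solution $x$ of $$\dot x(t)=A(t)x(t)+g(t,x(t))\ \text{ for almost every } t,\qquad x(t_0)=x_0,$$ with $t_0\ge0$ and $x_0\in\mathbb R^n$ (an absolutely continuous function on an interval $[t_0,T]$, with $T\ge t_0$ arbitrary) satisfies, for all $t\in[t_0,T]$, $$|x(t)|\le k_1e^{-k_2(t-t_0)}|x_0|+k_3\max_{\tau\in[t_0,t]}\delta(\tau).$$ -/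

import Mathlib

open Set Filter Topology MeasureTheory
-- norms of matrices are operator norms induced by the Euclidean 2-norm
open scoped Matrix.Norms.L2Operator

noncomputable section

/-- The spectral abscissa `α(M) = max {Re z : z ∈ ℂ, det (z I - M) = 0}` of a real square matrix. -/
def spectralAbscissa {n : ℕ} (M : Matrix (Fin n) (Fin n) ℝ) : ℝ :=
  sSup (Complex.re '' {z : ℂ |
    (z • (1 : Matrix (Fin n) (Fin n) ℂ) - M.map (fun r : ℝ => (r : ℂ))).det = 0})

/-- The ramp function `s ↦ max {s, 0}`. -/
def ramp (s : ℝ) : ℝ := max s 0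

/-- `φ_κ(M) = ramp (α(M) + κ)`. -/
def phi {n : ℕ} (κ : ℝ) (M : Matrix (Fin n) (Fin n) ℝ) : ℝ :=
  ramp (spectralAbscissa M + κ)

/-- The shifted matrix `M̃ = M - φ_κ(M) I`. -/
def shifted {n : ℕ} (κ : ℝ) (M : Matrix (Fin n) (Fin n) ℝ) : Matrix (Fin n) (Fin n) ℝ :=
  M - phi κ M • (1 : Matrix (Fin n) (Fin n) ℝ)

/-- `‖e^{s M̃}‖ ≤ c e^{-β s}` for all `s ≥ 0`, where `M̃ = M - φ_κ(M) I`. -/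
def DecayBound {n : ℕ} (κ β c : ℝ) (M : Matrix (Fin n) (Fin n) ℝ) : Prop :=
  ∀ s : ℝ, 0 ≤ s → ‖NormedSpace.exp (s • shifted κ M)‖ ≤ c * Real.exp (-β * s)

/-- `c₁ = 1 / (2 (L + ramp (α_max + κ)))`. -/
def lowerConst (L αmax κ : ℝ) : ℝ := 1 / (2 * (L + ramp (αmax + κ)))

/-- `c₂ = c² / (2 β)`. -/
def upperConst (c β : ℝ) : ℝ := c ^ 2 / (2 * β)

/-- Absolute continuity of `f` on the open interval `(a, b)`: for every `ε > 0` there is `δ > 0`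
such that every finite family of disjoint subintervals with end points in `(a, b)` and total length
less than `δ` satisfies `∑ dist (f (u i)) (f (v i)) < ε`. -/
def AbsContOnIoo {X : Type*} [PseudoMetricSpace X] (f : ℝ → X) (a b : ℝ) : Prop :=
  ∀ ε : ℝ, 0 < ε → ∃ δ : ℝ, 0 < δ ∧ ∀ (m : ℕ) (u v : ℕ → ℝ),
    (∀ i < m, a < u i ∧ u i ≤ v i ∧ v i < b) →
    (∀ i < m, ∀ j < m, i ≠ j → Disjoint (Ioc (u i) (v i)) (Ioc (u j) (v j))) →
    ∑ i ∈ Finset.range m, (v i - u i) < δ →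
    ∑ i ∈ Finset.range m, dist (f (u i)) (f (v i)) < ε

/-- The trajectory is bounded by `L > 0` and its spectral abscissa is at most `αmax`.
Trajectories live on `[0, ∞)`; values at negative times are never used. -/
structure BoundedTrajectory {n : ℕ} (A : ℝ → Matrix (Fin n) (Fin n) ℝ) (L αmax : ℝ) : Prop where
  pos : 0 < L
  norm_le : ∀ t : ℝ, 0 ≤ t → ‖A t‖ ≤ L
  abscissa_le : ∀ t : ℝ, 0 ≤ t → spectralAbscissa (A t) ≤ αmax

/-- The jump times: those `t > 0` for which `A(t)` is not the left limit of `A` at `t`. -/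
def jumpTimes {n : ℕ} (A : ℝ → Matrix (Fin n) (Fin n) ℝ) : Set ℝ :=
  {t : ℝ | 0 < t ∧ ¬ Tendsto A (𝓝[<] t) (𝓝 (A t))}

/-- The trajectory is càdlàg on `[0, ∞)`, has finitely many jumps in every bounded interval, and
`A` and `α(A)` are absolutely continuous on every open interval that contains no jump time. -/
structure PiecewiseRegular {n : ℕ} (A : ℝ → Matrix (Fin n) (Fin n) ℝ) : Prop where
  right_cont : ∀ t : ℝ, 0 ≤ t → ContinuousWithinAt A (Ici t) t
  left_lim : ∀ t : ℝ, 0 < t → ∃ M : Matrix (Fin n) (Fin n) ℝ, Tendsto A (𝓝[<] t) (𝓝 M)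
  finite_jumps : ∀ a b : ℝ, 0 ≤ a → a < b → (jumpTimes A ∩ Ioo a b).Finite
  absCont : ∀ a b : ℝ, 0 ≤ a → a < b → jumpTimes A ∩ Ioo a b = ∅ → AbsContOnIoo A a b
  absCont_abscissa : ∀ a b : ℝ, 0 ≤ a → a < b → jumpTimes A ∩ Ioo a b = ∅ →
    AbsContOnIoo (fun t => spectralAbscissa (A t)) a b

/-- The perturbation is (locally) Lebesgue integrable in `t`, locally Lipschitz in `x`, and
`|g(t, x)| ≤ γ(t) |x| + δ(t)` with `γ`, `δ` continuous and non-negative on `[0, ∞)`. -/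
structure AdmissiblePerturbation {n : ℕ}
    (g : ℝ → EuclideanSpace ℝ (Fin n) → EuclideanSpace ℝ (Fin n)) (γ δ : ℝ → ℝ) : Prop where
  integrable : ∀ x : EuclideanSpace ℝ (Fin n), ∀ T : ℝ, 0 ≤ T →
    IntegrableOn (fun t => g t x) (Icc 0 T) volume
  lipschitz : ∀ t : ℝ, 0 ≤ t → LocallyLipschitz (g t)
  gamma_cont : ContinuousOn γ (Ici 0)
  gamma_nonneg : ∀ t : ℝ, 0 ≤ t → 0 ≤ γ t
  delta_cont : ContinuousOn δ (Ici 0)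
  delta_nonneg : ∀ t : ℝ, 0 ≤ t → 0 ≤ δ t
  norm_le : ∀ t : ℝ, 0 ≤ t → ∀ x : EuclideanSpace ℝ (Fin n), ‖g t x‖ ≤ γ t * ‖x‖ + δ t

/-- `x` is a (Carathéodory) solution of `ẋ = A(t) x + g(t, x)` on `[t₀, T]` with `x(t₀) = x₀`:
it is absolutely continuous and satisfies the equation at almost every time. -/
structure IsSolution {n : ℕ} (A : ℝ → Matrix (Fin n) (Fin n) ℝ)
    (g : ℝ → EuclideanSpace ℝ (Fin n) → EuclideanSpace ℝ (Fin n))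
    (t₀ T : ℝ) (x₀ : EuclideanSpace ℝ (Fin n)) (x : ℝ → EuclideanSpace ℝ (Fin n)) : Prop where
  init : x t₀ = x₀
  absCont : AbsolutelyContinuousOnInterval x t₀ T
  ode : ∀ᵐ t ∂(volume : Measure ℝ), t ∈ Ioo t₀ T →
    HasDerivAt x (WithLp.toLp 2 ((A t).mulVec (WithLp.ofLp (x t))) + g t (x t)) t

/-- For all `0 ≤ t_a ≤ t_b`,
`c₁ ∫ φ_κ(A) + c₂ ∫ γ + c₂² TV(Ã) ≤ λ (t_b - t_a) + ϱ` over `[t_a, t_b]`, as an inequality of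
extended reals (so that the total variation of `Ã = A - φ_κ(A) I` is in particular finite). -/
def MixedCondition {n : ℕ} (A : ℝ → Matrix (Fin n) (Fin n) ℝ) (γ : ℝ → ℝ)
    (κ c₁ c₂ lam ρ : ℝ) : Prop :=
  ∀ ta tb : ℝ, 0 ≤ ta → ta ≤ tb →
    ((c₁ * (∫ τ in ta..tb, phi κ (A τ)) + c₂ * (∫ τ in ta..tb, γ τ) : ℝ) : EReal)
      + ((c₂ ^ 2 : ℝ) : EReal) *
        ((eVariationOn (fun t => shifted κ (A t)) (Icc ta tb) : ENNReal) : EReal)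
      ≤ ((lam * (tb - ta) + ρ : ℝ) : EReal)

end

/-!
For fixed `t` the shifted matrix `Ã = A - φ_κ(A) I` satisfies `‖e^{sÃ}‖ ≤ c e^{-βs}`, so the
Lyapunov equation `Ãᵀ P + P Ã = -I` has the solution `P = ∫₀^∞ (e^{sÃ})ᵀ e^{sÃ} ds`, and the
quadratic form `V(t, x) = xᵀ P(t) x` satisfies `c₁ |x|² ≤ V ≤ c₂ |x|²`. Along a solution three
effects compete with the decay `-|x|² ≤ -V / c₂`: the shift contributes `2 φ_κ(A) V`, the
perturbation at most `(2 c₂ / c₁) γ V` plus a source term, and the motion of `P` at most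
`(2 c₂² / c₁) ‖dÃ‖ V`. The left-hand side of the mixed condition is exactly `c₁ / 2` times the
integrated sum of these rates, so `lam < c₁ / (2 c₂)` leaves a net rate `-2 μ < 0`. Half of it is
spent on absorbing the source term.

The variation of `Ã` is handled without differentiating `P` or integrating against `dÃ`. For any two
exponentially stable generators, `V' ≤ (1 + 2 c₂ ‖T - T'‖) V` (`inner_lyapunovOp_le_mul`), whatever
the size of `T - T'`; thus jumps and continuous motion are treated alike. On a short interval
`[s, t]` the Lyapunov function is frozen at time `s`, and Grönwall's inequality for absolutely
continuous functions (`gronwall_absolutelyContinuous`) is applied; the error made by freezing is of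
order `Var(Ã; [s, t]) (t - s)`, and passing from `V(s, ·)` to `V(t, ·)` costs a factor
`exp ((2 c₂² / c₁) Var(Ã; [s, t]))` (`lyapunovFun_step`). Over a fine partition the former errors
add up to an arbitrarily small amount, whence constants independent of the solution
(`le_of_local_gronwall`). The regularity of `A` serves only to make `φ_κ(A(t))` integrable.

The uniform constant `c` comes from the Cayley–Hamilton theorem: the product of the factors `M - z`
over the eigenvalues `z` of `M`, with multiplicity, vanishes, and removing one factor at a time gives
`‖e^{sM}‖ ≤ K e^{α(M) s} (1 + R s)^n` with `K`, `R` depending only on `n` and a bound for `‖M‖`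
(`norm_exp_smul_mul_le`, `exists_norm_exp_le`). The shift makes `α(M) - φ_κ(M) ≤ -κ < -β`.
-/

/-! ### A uniform bound for the matrix exponential -/

/-- If `∏ (C - z)`, over a multiset of `k` numbers `z` of real part at most `a`, annihilates `X`, then
`e^{sC} X` grows at most like `e^{as} (1 + R s)^k`. The induction peels off one factor `C - z`:
the derivative of `e^{-zs} e^{sC} X` is `e^{-zs} e^{sC} (C - z) X`. -/
lemma norm_exp_smul_mul_le {𝔸 : Type*} [NormedRing 𝔸] [NormedAlgebra ℂ 𝔸] [CompleteSpace 𝔸]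
    (C : 𝔸) {a R : ℝ} (hR : 0 ≤ R) (S : Multiset ℂ) :
    (∀ z ∈ S, z.re ≤ a ∧ ‖C - algebraMap ℂ 𝔸 z‖ ≤ R) →
    ∀ X : 𝔸, Polynomial.aeval C (S.map fun z => Polynomial.X - Polynomial.C z).prod * X = 0 →
    ∀ s : ℝ, 0 ≤ s → ‖NormedSpace.exp (s • C) * X‖
      ≤ Real.exp (a * s) * (1 + R * s) ^ (Multiset.card S) * ‖X‖ := by
  induction S using Multiset.induction_on with
  | empty =>
    intro _ X hX s _
    have : X = 0 := by simpa using hX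
    simp [this]
  | cons z S ih =>
    intro hS X hX s hs
    have hz := hS z (by simp)
    set Y : 𝔸 := (C - algebraMap ℂ 𝔸 z) * X with hYdef
    have hY : Polynomial.aeval C (S.map fun z => Polynomial.X - Polynomial.C z).prod * Y = 0 := by
      rw [← hX, hYdef, Multiset.map_cons, Multiset.prod_cons, mul_comm, map_mul, mul_assoc]
      simp
    have hYn : ‖Y‖ ≤ R * ‖X‖ :=
      (norm_mul_le _ _).trans (mul_le_mul_of_nonneg_right hz.2 (norm_nonneg _))
    have ihY := ih (fun w hw => hS w (by simp [hw])) Y hY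
    set k := Multiset.card S
    let f : ℝ → 𝔸 := fun u => Complex.exp (-(z * u)) • (NormedSpace.exp (u • C) * X)
    have hf : ∀ u : ℝ, HasDerivAt f (Complex.exp (-(z * u)) • (NormedSpace.exp (u • C) * Y)) u := by
      intro u
      have h1 : HasDerivAt (fun u : ℝ => Complex.exp (-(z * u)))
          (Complex.exp (-(z * u)) * (-z)) u := by
        have h0 : HasDerivAt (fun u : ℝ => -(z * (u : ℂ))) (-z) u := by
          simpa using ((Complex.ofRealCLM.hasDerivAt (x := u)).const_mul z).fun_neg
        exact h0.cexp
      have h2 : HasDerivAt (fun u : ℝ => NormedSpace.exp (u • C) * X)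
          (NormedSpace.exp (u • C) * C * X) u :=
        (hasDerivAt_exp_smul_const (𝕂 := ℝ) C u).mul_const X
      refine (h1.fun_smul h2).congr_deriv ?_
      rw [hYdef, sub_mul, mul_sub, smul_sub, ← mul_assoc, Algebra.algebraMap_eq_smul_one,
        smul_mul_assoc, one_mul, mul_smul_comm, mul_smul, neg_smul, smul_neg, sub_eq_add_neg]
    have hnexp : ∀ u : ℝ, ‖Complex.exp (-(z * u))‖ = Real.exp (-(z.re * u)) := by
      intro u; simp [Complex.norm_exp]
    have hbd : ∀ u ∈ Ico (0 : ℝ) s, ‖Complex.exp (-(z * u)) • (NormedSpace.exp (u • C) * Y)‖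
        ≤ Real.exp ((a - z.re) * s) * (1 + R * s) ^ k * (R * ‖X‖) := by
      intro u hu
      rw [norm_smul, hnexp]
      calc _ ≤ Real.exp (-(z.re * u)) * (Real.exp (a * u) * (1 + R * u) ^ k * ‖Y‖) := by
            gcongr; exact ihY u hu.1
        _ = Real.exp ((a - z.re) * u) * (1 + R * u) ^ k * ‖Y‖ := by
            rw [← mul_assoc, ← mul_assoc, ← Real.exp_add]; ring_nf
        _ ≤ _ := by
            have h3 : (a - z.re) * u ≤ (a - z.re) * s :=
              mul_le_mul_of_nonneg_left hu.2.le (by linarith [hz.1])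
            have h4 : 0 ≤ R * u := mul_nonneg hR hu.1
            have h5 : R * u ≤ R * s := mul_le_mul_of_nonneg_left hu.2.le hR
            gcongr
    have hmv := norm_image_sub_le_of_norm_deriv_le_segment'
      (fun u _ => (hf u).hasDerivWithinAt) hbd s ⟨hs, le_rfl⟩
    have hf0 : f 0 = X := by simp [f]
    have hfs : ‖NormedSpace.exp (s • C) * X‖ = Real.exp (z.re * s) * ‖f s‖ := by
      simp only [f, norm_smul, hnexp]
      rw [← mul_assoc, ← Real.exp_add]; simp
    rw [hf0, sub_zero] at hmv
    have hfs' : ‖f s‖ ≤ ‖X‖ + Real.exp ((a - z.re) * s) * (1 + R * s) ^ k * (R * ‖X‖) * s := by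
      have := norm_le_norm_add_norm_sub' (f s) X
      linarith
    have hRs : 0 ≤ R * s := mul_nonneg hR hs
    have h1 : 1 ≤ (1 + R * s) ^ k := one_le_pow₀ (by linarith)
    have h2 : Real.exp (z.re * s) ≤ Real.exp (a * s) :=
      Real.exp_le_exp.2 (mul_le_mul_of_nonneg_right hz.1 hs)
    have h3 : Real.exp (z.re * s) * Real.exp ((a - z.re) * s) = Real.exp (a * s) := by
      rw [← Real.exp_add]; ring_nf
    rw [hfs, Multiset.card_cons, pow_succ]
    calc _ ≤ Real.exp (z.re * s) *
          (‖X‖ + Real.exp ((a - z.re) * s) * (1 + R * s) ^ k * (R * ‖X‖) * s) := by gcongr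
      _ = Real.exp (z.re * s) * ‖X‖
          + Real.exp (a * s) * ((1 + R * s) ^ k * (R * s)) * ‖X‖ := by rw [← h3]; ring
      _ ≤ Real.exp (a * s) * (1 + R * s) ^ k * ‖X‖
          + Real.exp (a * s) * ((1 + R * s) ^ k * (R * s)) * ‖X‖ := by
            gcongr
            nlinarith [Real.exp_pos (a * s)]
      _ = _ := by ring

/-- The spectral abscissa bounds the real parts of all complex eigenvalues: these form a finite set,
so that the supremum defining it is a genuine one. -/
lemma re_le_spectralAbscissa {n : ℕ} (M : Matrix (Fin n) (Fin n) ℝ) {z : ℂ}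
    (hz : z ∈ (M.map (fun r : ℝ => (r : ℂ))).charpoly.roots) : z.re ≤ spectralAbscissa M := by
  have hset : {z : ℂ | (z • (1 : Matrix (Fin n) (Fin n) ℂ)
      - M.map (fun r : ℝ => (r : ℂ))).det = 0}
      = {z | z ∈ (M.map (fun r : ℝ => (r : ℂ))).charpoly.roots} := by
    ext w
    rw [mem_ofPred_eq, mem_ofPred_eq, Polynomial.mem_roots (Matrix.charpoly_monic _).ne_zero,
      Polynomial.IsRoot.def, Matrix.eval_charpoly, Matrix.scalar_apply, Matrix.smul_one_eq_diagonal]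
  refine le_csSup ?_ ⟨z, by rw [hset]; exact hz, rfl⟩
  rw [hset]
  refine (Set.Finite.image _ ?_).bddAbove
  exact (Multiset.finite_toSet _)

/-- The growth of `e^{sM}` is governed by the spectral abscissa of `M` up to a polynomial factor of
degree `n`, uniformly over bounded sets of matrices. -/
lemma exists_norm_exp_le {n : ℕ} (L : ℝ) :
    ∃ K R : ℝ, 0 ≤ K ∧ 0 ≤ R ∧ ∀ M : Matrix (Fin n) (Fin n) ℝ, ‖M‖ ≤ L → ∀ s : ℝ, 0 ≤ s →
      ‖NormedSpace.exp (s • M)‖ ≤ K * Real.exp (spectralAbscissa M * s) * (1 + R * s) ^ n := by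
  let ι : Matrix (Fin n) (Fin n) ℝ →ₐ[ℝ] Matrix (Fin n) (Fin n) ℂ :=
    (Complex.ofRealAm).mapMatrix
  let π : Matrix (Fin n) (Fin n) ℂ →ₗ[ℝ] Matrix (Fin n) (Fin n) ℝ :=
    Complex.reLm.mapMatrix
  let ιc := LinearMap.toContinuousLinearMap ι.toLinearMap
  let πc := LinearMap.toContinuousLinearMap π
  have hπι : ∀ M, π (ι M) = M := by intro M; ext i j; simp [π, ι]
  have hι : ∀ M, ι M = M.map (fun r : ℝ => (r : ℂ)) := by intro M; ext i j; simp [ι]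
  have hιc : Continuous ι := ιc.continuous
  set o : ℝ := ‖(1 : Matrix (Fin n) (Fin n) ℂ)‖
  let R : ℝ := ‖ιc‖ * |L| + ‖ιc‖ * |L| * o * o
  have hR : 0 ≤ R := by positivity
  refine ⟨‖πc‖ * o, R, by positivity, hR, fun M hM s hs => ?_⟩
  have hιM : ‖ι M‖ ≤ ‖ιc‖ * |L| :=
    (ιc.le_opNorm M).trans (mul_le_mul_of_nonneg_left (hM.trans (le_abs_self _)) (norm_nonneg _))
  have hsp : (ι M).charpoly.Splits := IsAlgClosed.splits _
  have hprod := hsp.eq_prod_roots_of_monic (Matrix.charpoly_monic _)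
  have key := norm_exp_smul_mul_le (ι M) (a := spectralAbscissa M) hR (ι M).charpoly.roots
    (fun z hz => ⟨re_le_spectralAbscissa M (by rwa [← hι]), ?_⟩) 1
    (by rw [← hprod, Matrix.aeval_self_charpoly, zero_mul]) s hs
  · have hcard : Multiset.card (ι M).charpoly.roots = n := by
      rw [← hsp.natDegree_eq_card_roots, Matrix.charpoly_natDegree_eq_dim, Fintype.card_fin]
    rw [mul_one, hcard] at key
    have hexp : NormedSpace.exp (s • M) = π (NormedSpace.exp (s • ι M)) := by
      let _ : NormedAlgebra ℚ (Matrix (Fin n) (Fin n) ℝ) := .restrictScalars ℚ ℝ _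
      rw [← map_smul, ← NormedSpace.map_exp ι hιc, hπι]
    rw [hexp]
    calc _ ≤ ‖πc‖ * ‖NormedSpace.exp (s • ι M)‖ := πc.le_opNorm _
      _ ≤ ‖πc‖ * (Real.exp (spectralAbscissa M * s) * (1 + R * s) ^ n * o) := by gcongr
      _ = _ := by ring
  · have hzs : z ∈ spectrum ℂ (ι M) := by
      rw [Matrix.mem_spectrum_iff_isRoot_charpoly]
      exact Polynomial.isRoot_of_mem_roots hz
    have hz' := spectrum.norm_le_norm_mul_of_mem hzs
    refine (norm_sub_le _ _).trans (add_le_add hιM ?_)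
    rw [norm_algebraMap]
    calc _ ≤ ‖ι M‖ * o * o := by gcongr
      _ ≤ _ := by gcongr

lemma shifted_exp {n : ℕ} (κ s : ℝ) (M : Matrix (Fin n) (Fin n) ℝ) :
    NormedSpace.exp (s • shifted κ M) = Real.exp (-(phi κ M * s)) • NormedSpace.exp (s • M) := by
  have h : s • shifted κ M = s • M + algebraMap ℝ _ (-(phi κ M * s)) := by
    rw [shifted, Algebra.algebraMap_eq_smul_one, smul_sub, smul_smul, neg_smul, mul_comm,
      sub_eq_add_neg]
  let _ : NormedAlgebra ℚ (Matrix (Fin n) (Fin n) ℝ) := .restrictScalars ℚ ℝ _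
  rw [h, NormedSpace.exp_add_of_commute (Algebra.commutes _ _).symm,
    ← NormedSpace.algebraMap_exp_comm, ← Real.exp_eq_exp_ℝ, Algebra.algebraMap_eq_smul_one,
    mul_smul_comm, mul_one]

lemma exists_pow_mul_exp_neg_le (R : ℝ) (hR : 0 ≤ R) (n : ℕ) {η : ℝ} (hη : 0 < η) :
    ∃ C : ℝ, 0 < C ∧ ∀ s : ℝ, 0 ≤ s → (1 + R * s) ^ n ≤ C * Real.exp (η * s) := by
  -- `1 + y ≤ m e^{y/m}` for `m ≥ 1`, and this `m` is large enough for `n R / m ≤ η`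
  let m : ℝ := 1 + n * R / η
  have hm : 1 ≤ m := by simp only [m]; linarith [show 0 ≤ n * R / η by positivity]
  refine ⟨m ^ n, by positivity, fun s hs => ?_⟩
  have h1 : 1 + R * s ≤ m * Real.exp (R * s / m) := by
    calc 1 + R * s ≤ m * (R * s / m + 1) := by field_simp; linarith
      _ ≤ _ := by gcongr; exact Real.add_one_le_exp _
  calc _ ≤ (m * Real.exp (R * s / m)) ^ n := by gcongr
    _ = m ^ n * Real.exp (n * (R * s / m)) := by rw [mul_pow, ← Real.exp_nat_mul]
    _ ≤ _ := by
      refine mul_le_mul_of_nonneg_left (Real.exp_le_exp.2 ?_) (by positivity)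
      have : n * R ≤ η * m := by simp only [m]; field_simp; linarith
      rw [← mul_div_assoc, div_le_iff₀ (by linarith)]
      nlinarith

/-- The shifted matrices satisfy a decay bound that is uniform over bounded sets. -/
lemma exists_decayBound {n : ℕ} {L κ β : ℝ} (hβκ : β < κ) :
    ∃ c : ℝ, 0 < c ∧ ∀ M : Matrix (Fin n) (Fin n) ℝ, ‖M‖ ≤ L → DecayBound κ β c M := by
  obtain ⟨K, R, hK, hR, hb⟩ := exists_norm_exp_le (n := n) L
  obtain ⟨C, hC, hCb⟩ := exists_pow_mul_exp_neg_le R hR n (sub_pos.2 hβκ)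
  refine ⟨K * C + 1, by positivity, fun M hM s hs => ?_⟩
  have hφ : spectralAbscissa M + κ ≤ phi κ M := le_max_left _ _
  rw [shifted_exp, norm_smul, Real.norm_eq_abs, Real.abs_exp]
  calc _ ≤ Real.exp (-(phi κ M * s)) * (K * Real.exp (spectralAbscissa M * s) *
        (C * Real.exp ((κ - β) * s))) := by
        gcongr
        exact (hb M hM s hs).trans (by gcongr; exact hCb s hs)
    _ = K * C * Real.exp ((spectralAbscissa M - phi κ M + κ - β) * s) := by
        rw [show (spectralAbscissa M - phi κ M + κ - β) * s = -(phi κ M * s) +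
          spectralAbscissa M * s + (κ - β) * s by ring, Real.exp_add, Real.exp_add]
        ring
    _ ≤ (K * C + 1) * Real.exp (-β * s) := by
        gcongr
        · linarith
        · linarith

/-! ### The Lyapunov operator of an exponentially stable generator -/

section Lyapunov

open NormedSpace InnerProductSpace
open scoped InnerProduct

lemma exp_smul_apply_comm {E : Type*} [NormedAddCommGroup E] [NormedSpace ℝ E]
    (T : E →L[ℝ] E) (s : ℝ) (x : E) :
    exp (s • T) (T x) = T (exp (s • T) x) := by
  have h : Commute (exp (s • T)) T := ((Commute.refl T).smul_left s).exp_left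
  exact congrArg (fun S : E →L[ℝ] E => S x) h.eq

variable {E : Type*} [NormedAddCommGroup E] [InnerProductSpace ℝ E] [CompleteSpace E]

/-- `T` generates an exponentially decaying semigroup: `‖e^{sT}‖ ≤ c e^{-βs}` for `s ≥ 0`. -/
def ExpDecay (β c : ℝ) (T : E →L[ℝ] E) : Prop :=
  ∀ s : ℝ, 0 ≤ s → ‖exp (s • T)‖ ≤ c * Real.exp (-β * s)

/-- The solution `P = ∫₀^∞ (e^{sT})† e^{sT} ds` of the Lyapunov equation `T† P + P T = -1`.
The integral converges when `T` satisfies `ExpDecay`, and is `0` where it does not converge. -/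
noncomputable def lyapunovOp (T : E →L[ℝ] E) : E →L[ℝ] E :=
  ∫ s in Ioi (0 : ℝ), (exp (s • T))† * exp (s • T)

variable {β c : ℝ} {T : E →L[ℝ] E}

lemma continuous_exp_smul (T : E →L[ℝ] E) : Continuous fun s : ℝ => exp (s • T) :=
  (differentiable_exp_smul_const ℝ T).continuous

lemma norm_adjoint_exp_mul_exp_le (hT : ExpDecay β c T) {s : ℝ} (hs : 0 ≤ s) :
    ‖(exp (s • T))† * exp (s • T)‖ ≤ c ^ 2 * Real.exp (-(2 * β) * s) := by
  calc _ ≤ ‖exp (s • T)‖ * ‖exp (s • T)‖ := by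
        refine (norm_mul_le _ _).trans ?_
        rw [LinearIsometryEquiv.norm_map]
    _ ≤ (c * Real.exp (-β * s)) * (c * Real.exp (-β * s)) :=
        mul_self_le_mul_self (norm_nonneg _) (hT s hs)
    _ = c ^ 2 * (Real.exp (-β * s) * Real.exp (-β * s)) := by ring
    _ = _ := by rw [← Real.exp_add]; ring_nf

lemma integrableOn_decay (c : ℝ) (hβ : 0 < β) :
    IntegrableOn (fun s : ℝ => c ^ 2 * Real.exp (-(2 * β) * s)) (Ioi 0) :=
  (integrableOn_exp_mul_Ioi (by linarith) 0).const_mul _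

lemma integrableOn_adjoint_exp_mul_exp (hT : ExpDecay β c T) (hβ : 0 < β) :
    IntegrableOn (fun s : ℝ => (exp (s • T))† * exp (s • T)) (Ioi 0) := by
  refine (integrableOn_decay c hβ).mono' ?_ ?_
  · exact (((ContinuousLinearMap.adjoint (𝕜 := ℝ) (E := E) (F := E)).continuous.comp
      (continuous_exp_smul T)).mul (continuous_exp_smul T)).aestronglyMeasurable
  · exact (ae_restrict_mem measurableSet_Ioi).mono fun s hs =>
      norm_adjoint_exp_mul_exp_le hT (mem_Ioi.1 hs).le

lemma norm_lyapunovOp_le (hT : ExpDecay β c T) (hβ : 0 < β) :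
    ‖lyapunovOp T‖ ≤ c ^ 2 / (2 * β) := by
  refine (norm_integral_le_of_norm_le (integrableOn_decay c hβ)
    ((ae_restrict_mem measurableSet_Ioi).mono fun s hs =>
      norm_adjoint_exp_mul_exp_le hT (mem_Ioi.1 hs).le)).trans_eq ?_
  rw [integral_const_mul, integral_exp_mul_Ioi (by linarith)]
  simp; field_simp

lemma inner_lyapunovOp (hT : ExpDecay β c T) (hβ : 0 < β) (x y : E) :
    ⟪lyapunovOp T x, y⟫_ℝ = ∫ s in Ioi (0 : ℝ), ⟪exp (s • T) x, exp (s • T) y⟫_ℝ := by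
  have h1 := integrableOn_adjoint_exp_mul_exp hT hβ
  rw [lyapunovOp, ContinuousLinearMap.integral_apply h1, real_inner_comm,
    ← integral_inner (h1.apply_continuousLinearMap x)]
  refine integral_congr_ae (ae_of_all _ fun s => ?_)
  simp only [mul_apply_eq_comp]
  rw [ContinuousLinearMap.adjoint_inner_right, real_inner_comm]

lemma integrableOn_inner_exp (hT : ExpDecay β c T) (hβ : 0 < β) (x y : E) (Q : E →L[ℝ] E) :
    IntegrableOn (fun s : ℝ => ⟪Q (exp (s • T) x), exp (s • T) y⟫_ℝ) (Ioi 0) := by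
  have hcont : ∀ z : E, Continuous fun s : ℝ => exp (s • T) z := fun z =>
    (continuous_exp_smul T).clm_apply continuous_const
  refine ((integrableOn_decay c hβ).const_mul (‖Q‖ * ‖x‖ * ‖y‖)).mono' ?_ ?_
  · exact ((Q.continuous.comp (hcont x)).inner (hcont y)).aestronglyMeasurable
  · refine (ae_restrict_mem measurableSet_Ioi).mono fun s hs => ?_
    have hd := hT s (mem_Ioi.1 hs).le
    have hb : ∀ z : E, ‖exp (s • T) z‖ ≤ c * Real.exp (-β * s) * ‖z‖ := fun z =>
      (ContinuousLinearMap.le_opNorm _ z).trans (by gcongr)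
    calc _ ≤ ‖Q (exp (s • T) x)‖ * ‖exp (s • T) y‖ := norm_inner_le_norm _ _
      _ ≤ (‖Q‖ * (c * Real.exp (-β * s) * ‖x‖)) * (c * Real.exp (-β * s) * ‖y‖) := by
          have h0 : 0 ≤ c * Real.exp (-β * s) := (norm_nonneg _).trans hd
          gcongr
          · exact (Q.le_opNorm _).trans (by gcongr; exact hb x)
          · exact hb y
      _ = ‖Q‖ * ‖x‖ * ‖y‖ * (c ^ 2 * (Real.exp (-β * s) * Real.exp (-β * s))) := by ring
      _ = _ := by rw [← Real.exp_add]; ring_nf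

lemma lyapunovOp_symm (hT : ExpDecay β c T) (hβ : 0 < β) (x y : E) :
    ⟪lyapunovOp T x, y⟫_ℝ = ⟪x, lyapunovOp T y⟫_ℝ := by
  rw [inner_lyapunovOp hT hβ, real_inner_comm, inner_lyapunovOp hT hβ]
  exact integral_congr_ae (ae_of_all _ fun s => real_inner_comm _ _)

/-- Integration of the derivative of `⟪Q y, y⟫` along the trajectory `y = e^{sT} x`. -/
lemma integral_deriv_quadratic (hT : ExpDecay β c T) (hβ : 0 < β) (Q : E →L[ℝ] E) (x : E) :
    ∫ s in Ioi (0 : ℝ), (⟪Q (exp (s • T) x), T (exp (s • T) x)⟫_ℝ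
      + ⟪Q (T (exp (s • T) x)), exp (s • T) x⟫_ℝ) = -⟪Q x, x⟫_ℝ := by
  have hy : ∀ s : ℝ, HasDerivAt (fun s : ℝ => exp (s • T) x) (T (exp (s • T) x)) s := fun s => by
    have := (hasDerivAt_exp_smul_const' (𝕂 := ℝ) T s).clm_apply (hasDerivAt_const s x)
    simpa using this
  have hd : ∀ s ∈ Ici (0 : ℝ), HasDerivAt (fun s : ℝ => ⟪Q (exp (s • T) x), exp (s • T) x⟫_ℝ)
      (⟪Q (exp (s • T) x), T (exp (s • T) x)⟫_ℝ
        + ⟪Q (T (exp (s • T) x)), exp (s • T) x⟫_ℝ) s := fun s _ =>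
    (Q.hasFDerivAt.comp_hasDerivAt s (hy s)).inner ℝ (hy s)
  have hint : IntegrableOn (fun s : ℝ => ⟪Q (exp (s • T) x), T (exp (s • T) x)⟫_ℝ
        + ⟪Q (T (exp (s • T) x)), exp (s • T) x⟫_ℝ) (Ioi 0) := by
    simp_rw [← exp_smul_apply_comm]
    exact (integrableOn_inner_exp hT hβ x (T x) Q).add (integrableOn_inner_exp hT hβ (T x) x Q)
  rw [integral_Ioi_of_hasDerivAt_of_tendsto' hd hint (m := 0)]
  · simp
  · exact tendsto_zero_of_hasDerivAt_of_integrableOn_Ioi (a := 0)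
      (fun s hs => hd s (mem_Ioi.1 hs).le) hint (integrableOn_inner_exp hT hβ x x Q)

lemma lyapunov_equation (hT : ExpDecay β c T) (hβ : 0 < β) (x : E) :
    2 * ⟪lyapunovOp T x, T x⟫_ℝ = -‖x‖ ^ 2 := by
  have h := integral_deriv_quadratic hT hβ (ContinuousLinearMap.id ℝ E) x
  simp only [ContinuousLinearMap.id_apply, real_inner_self_eq_norm_sq] at h
  rw [← h, inner_lyapunovOp hT hβ, ← integral_const_mul]
  refine integral_congr_ae (ae_of_all _ fun s => ?_)
  simp only [exp_smul_apply_comm]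
  rw [real_inner_comm (exp (s • T) x) (T (exp (s • T) x))]
  ring

lemma inner_lyapunovOp_le (hT : ExpDecay β c T) (hβ : 0 < β) (x : E) :
    ⟪lyapunovOp T x, x⟫_ℝ ≤ c ^ 2 / (2 * β) * ‖x‖ ^ 2 := by
  calc _ ≤ ‖lyapunovOp T x‖ * ‖x‖ := real_inner_le_norm _ _
    _ ≤ c ^ 2 / (2 * β) * ‖x‖ * ‖x‖ := by
      gcongr
      exact ((lyapunovOp T).le_opNorm x).trans (by gcongr; exact norm_lyapunovOp_le hT hβ)
    _ = _ := by ring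

/-- `|x|² ≤ 2 ‖T‖ ⟪P x, x⟫`: integrate `d/ds |y|² = 2 ⟪y, T y⟫ ≥ -2 ‖T‖ |y|²` along `y = e^{sT} x`,
which tends to `0`. -/
lemma norm_sq_le_inner_lyapunovOp (hT : ExpDecay β c T) (hβ : 0 < β) (x : E) :
    ‖x‖ ^ 2 ≤ 2 * ‖T‖ * ⟪lyapunovOp T x, x⟫_ℝ := by
  have h := integral_deriv_quadratic hT hβ (ContinuousLinearMap.id ℝ E) x
  simp only [ContinuousLinearMap.id_apply, real_inner_self_eq_norm_sq] at h
  have h2 := integrableOn_inner_exp hT hβ x x (ContinuousLinearMap.id ℝ E)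
  have h3 := integrableOn_inner_exp hT hβ x (T x) (ContinuousLinearMap.id ℝ E)
  have h4 := integrableOn_inner_exp hT hβ (T x) x (ContinuousLinearMap.id ℝ E)
  simp only [ContinuousLinearMap.id_apply, exp_smul_apply_comm] at h2 h3 h4
  rw [← neg_eq_iff_eq_neg, ← integral_neg] at h
  rw [← h, inner_lyapunovOp hT hβ, ← integral_const_mul]
  refine integral_mono (h3.add h4).neg (h2.const_mul _) fun s => ?_
  set y := exp (s • T) x
  have hb : |⟪y, T y⟫_ℝ| ≤ ‖T‖ * ‖y‖ ^ 2 := by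
    calc _ ≤ ‖y‖ * ‖T y‖ := abs_real_inner_le_norm _ _
      _ ≤ ‖y‖ * (‖T‖ * ‖y‖) := by gcongr; exact T.le_opNorm y
      _ = _ := by ring
  have hb' := neg_abs_le ⟪y, T y⟫_ℝ
  simp only [real_inner_self_eq_norm_sq]
  rw [real_inner_comm y (T y)]
  linarith

lemma inner_lyapunovOp_nonneg (hT : ExpDecay β c T) (hβ : 0 < β) (x : E) :
    0 ≤ ⟪lyapunovOp T x, x⟫_ℝ := by
  rw [inner_lyapunovOp hT hβ]
  exact integral_nonneg fun s => real_inner_self_nonneg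

/-- The Lyapunov function depends on the generator in a Lipschitz way, over arbitrary differences:
`V' ≤ (1 + 2 c₂ ‖T - T'‖) V`. Along `y = e^{sT} x` the derivative of `⟪P' y, y⟫` is
`2 ⟪P' y, T' y⟫ + 2 ⟪P' y, (T - T') y⟫`, the first term being `-|y|²`. -/
lemma inner_lyapunovOp_le_mul {T' : E →L[ℝ] E} (hT : ExpDecay β c T) (hT' : ExpDecay β c T')
    (hβ : 0 < β) (x : E) :
    ⟪lyapunovOp T' x, x⟫_ℝ
      ≤ (1 + 2 * (c ^ 2 / (2 * β)) * ‖T - T'‖) * ⟪lyapunovOp T x, x⟫_ℝ := by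
  have h := integral_deriv_quadratic hT hβ (lyapunovOp T') x
  have h2 := integrableOn_inner_exp hT hβ x x (ContinuousLinearMap.id ℝ E)
  have h3 := integrableOn_inner_exp hT hβ x (T x) (lyapunovOp T')
  have h4 := integrableOn_inner_exp hT hβ (T x) x (lyapunovOp T')
  simp only [ContinuousLinearMap.id_apply, exp_smul_apply_comm] at h2 h3 h4
  rw [← neg_eq_iff_eq_neg, ← integral_neg] at h
  rw [← h, inner_lyapunovOp hT hβ, ← integral_const_mul]
  refine integral_mono (h3.add h4).neg (h2.const_mul _) fun s => ?_
  set y := exp (s • T) x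
  have hb : |⟪lyapunovOp T' y, (T - T') y⟫_ℝ| ≤ c ^ 2 / (2 * β) * ‖T - T'‖ * ‖y‖ ^ 2 := by
    calc _ ≤ ‖lyapunovOp T' y‖ * ‖(T - T') y‖ := abs_real_inner_le_norm _ _
      _ ≤ (c ^ 2 / (2 * β) * ‖y‖) * (‖T - T'‖ * ‖y‖) := by
        gcongr
        · exact ((lyapunovOp T').le_opNorm y).trans (by gcongr; exact norm_lyapunovOp_le hT' hβ)
        · exact (T - T').le_opNorm y
      _ = _ := by ring
  have hb' := neg_abs_le ⟪lyapunovOp T' y, (T - T') y⟫_ℝ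
  have he := lyapunov_equation hT' hβ y
  have hsymm : ⟪lyapunovOp T' (T y), y⟫_ℝ = ⟪lyapunovOp T' y, T y⟫_ℝ := by
    rw [lyapunovOp_symm hT' hβ, real_inner_comm]
  have hsub : ⟪lyapunovOp T' y, (T - T') y⟫_ℝ
      = ⟪lyapunovOp T' y, T y⟫_ℝ - ⟪lyapunovOp T' y, T' y⟫_ℝ := by
    rw [sub_apply, inner_sub_right]
  simp only [real_inner_self_eq_norm_sq, hsymm]
  linarith

end Lyapunov

/-! ### Absolutely continuous functions and Grönwall's inequality -/

lemma AbsolutelyContinuousOnInterval.lipschitzOnWith_comp {X Y : Type*} [PseudoMetricSpace X]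
    [PseudoMetricSpace Y] {f : ℝ → X} {ψ : X → Y} {a b : ℝ} {K : NNReal}
    (hf : AbsolutelyContinuousOnInterval f a b) (hψ : LipschitzOnWith K ψ (f '' uIcc a b)) :
    AbsolutelyContinuousOnInterval (fun t => ψ (f t)) a b := by
  rw [absolutelyContinuousOnInterval_iff] at hf ⊢
  intro ε hε
  obtain ⟨δ, hδ, h⟩ := hf (ε / (K + 1)) (by positivity)
  refine ⟨δ, hδ, fun I hI hlt => ?_⟩
  calc _ ≤ ∑ i ∈ Finset.range I.1, K * dist (f (I.2 i).1) (f (I.2 i).2) :=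
        Finset.sum_le_sum fun i hi => hψ.dist_le_mul _ (mem_image_of_mem f (hI.1 i hi).1) _
          (mem_image_of_mem f (hI.1 i hi).2)
    _ = K * ∑ i ∈ Finset.range I.1, dist (f (I.2 i).1) (f (I.2 i).2) := by rw [Finset.mul_sum]
    _ ≤ K * (ε / (K + 1)) := by gcongr; exact (h I hI hlt).le
    _ < ε := by
      rw [mul_div_assoc', div_lt_iff₀ (by positivity)]
      nlinarith [K.2]

lemma AbsolutelyContinuousOnInterval.contDiff_comp {X Y : Type*} [NormedAddCommGroup X]
    [NormedSpace ℝ X] [FiniteDimensional ℝ X] [NormedAddCommGroup Y] [NormedSpace ℝ Y]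
    {f : ℝ → X} {ψ : X → Y} {a b : ℝ}
    (hf : AbsolutelyContinuousOnInterval f a b) (hψ : ContDiff ℝ 1 ψ) :
    AbsolutelyContinuousOnInterval (fun t => ψ (f t)) a b := by
  obtain ⟨C, hC⟩ := hf.exists_bound
  have : ProperSpace X := FiniteDimensional.proper ℝ X
  obtain ⟨K, hK⟩ := hψ.contDiffOn.exists_lipschitzOnWith (s := Metric.closedBall (0 : X) C)
    (by decide) (convex_closedBall _ _) (isCompact_closedBall _ _)
  refine hf.lipschitzOnWith_comp (hK.mono ?_)
  rintro _ ⟨t, ht, rfl⟩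
  simpa using hC t ht

/-- A Grönwall inequality for absolutely continuous functions, with integrable coefficient `h`
bounded below by `-m`. -/
lemma gronwall_absolutelyContinuous {q h : ℝ → ℝ} {s t D m : ℝ} (hst : s ≤ t)
    (hq : AbsolutelyContinuousOnInterval q s t) (hh : IntervalIntegrable h volume s t)
    (hD : 0 ≤ D) (hm : 0 ≤ m) (hhm : ∀ r ∈ Icc s t, -m ≤ h r)
    (hd : ∀ᵐ r, r ∈ Ioo s t → ∃ d, HasDerivAt q d r ∧ d ≤ h r * q r + D) :
    q t ≤ Real.exp (∫ r in s..t, h r) * (q s + D * Real.exp (m * (t - s)) * (t - s)) := by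
  set H : ℝ → ℝ := fun r => ∫ u in s..r, h u with hH
  have hHac : AbsolutelyContinuousOnInterval H s t :=
    hh.absolutelyContinuousOnInterval_intervalIntegral (by simp)
  set G : ℝ → ℝ := fun r => Real.exp (-H r) with hG
  have hGac : AbsolutelyContinuousOnInterval G s t :=
    hHac.contDiff_comp (ψ := fun y => Real.exp (-y)) (by fun_prop)
  have hw := hq.mul hGac
  have hle : ∫ r in s..t, deriv (q * G) r ≤ ∫ _ in s..t, D * Real.exp (m * (t - s)) := by
    refine intervalIntegral.integral_mono_ae_restrict hst hw.intervalIntegrable_deriv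
      intervalIntegrable_const ?_
    rw [← restrict_Ioo_eq_restrict_Icc]
    refine (ae_restrict_iff' measurableSet_Ioo).2 ?_
    filter_upwards [hd, hh.ae_hasDerivAt_integral] with r hr1 hr2 hr
    obtain ⟨d, hdq, hdle⟩ := hr1 hr
    have hrI : r ∈ Icc s t := Ioo_subset_Icc_self hr
    have hH' : HasDerivAt H (h r) r := hr2 (by rwa [uIcc_of_le hst]) s (by simp)
    have hG' : HasDerivAt G (Real.exp (-H r) * -h r) r := hH'.fun_neg.exp
    rw [(hdq.mul hG').deriv]
    have hHr : -(m * (t - s)) ≤ H r := by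
      have hsub : IntervalIntegrable h volume s r := hh.mono_set (by
        rw [uIcc_of_le hst, uIcc_of_le hrI.1]; exact Icc_subset_Icc_right hrI.2)
      have h2 : ∫ _ in s..r, -m ≤ H r :=
        intervalIntegral.integral_mono_on hrI.1 intervalIntegrable_const hsub
          fun u hu => hhm u ⟨hu.1, hu.2.trans hrI.2⟩
      rw [intervalIntegral.integral_const, smul_eq_mul] at h2
      nlinarith [hrI.1, hrI.2]
    calc d * G r + q r * (Real.exp (-H r) * -h r) = (d - h r * q r) * Real.exp (-H r) := by
          simp only [G]; ring
      _ ≤ D * Real.exp (m * (t - s)) := by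
          have : Real.exp (-H r) ≤ Real.exp (m * (t - s)) := Real.exp_le_exp.2 (by linarith)
          have h3 : d - h r * q r ≤ D := by linarith
          exact (mul_le_mul_of_nonneg_right h3 (Real.exp_pos _).le).trans
            (mul_le_mul_of_nonneg_left this hD)
  rw [hw.integral_deriv_eq_sub, intervalIntegral.integral_const] at hle
  have hHs : H s = 0 := by simp [H]
  simp only [Pi.mul_apply, hG, hHs, smul_eq_mul, neg_zero, Real.exp_zero, mul_one] at hle
  have h1 : q t = Real.exp (H t) * (q t * Real.exp (-H t)) := by
    rw [mul_left_comm, ← Real.exp_add]; simp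
  rw [h1]
  gcongr
  linarith

/-- Iterating, over a fine partition, an estimate with a multiplicative error of second order
`B (v t - v s) (t - s)` and a source term of first order. Since the mesh may be chosen after the
monotone function `v`, all constants are independent of `v`. -/
lemma le_of_local_gronwall {W F v : ℝ → ℝ} {a b B D m μ K : ℝ} (hab : a ≤ b)
    (hW : ∀ s ∈ Icc a b, 0 ≤ W s)
    (hv : MonotoneOn v (Icc a b)) (hB : 0 ≤ B) (hD : 0 ≤ D) (hμ : 0 < μ)
    (hF : ∀ s ∈ Icc a b, F b - F s ≤ -μ * (b - s) + K)
    (hstep : ∀ s ∈ Icc a b, ∀ t ∈ Icc a b, s ≤ t →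
      W t ≤ Real.exp (F t - F s + B * (v t - v s) * (t - s))
        * (W s + D * Real.exp (m * (t - s)) * (t - s))) :
    W b ≤ Real.exp (K + 1) * (Real.exp (-μ * (b - a)) * W a + D * Real.exp 1 / μ) := by
  obtain ⟨N, hN⟩ := exists_nat_ge (|m| * (b - a) + B * (v b - v a) * (b - a) + 1)
  have hvab : 0 ≤ v b - v a := sub_nonneg.2 (hv ⟨le_rfl, hab⟩ ⟨hab, le_rfl⟩ hab)
  have hba : 0 ≤ b - a := sub_nonneg.2 hab
  have hp1 : 0 ≤ |m| * (b - a) := by positivity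
  have hp2 : 0 ≤ B * (v b - v a) * (b - a) := by positivity
  have hN0 : (0 : ℝ) < N := by linarith
  set η : ℝ := (b - a) / N with hη
  have hη0 : 0 ≤ η := by positivity
  have hmη : m * η ≤ 1 := by
    rw [hη, mul_div_assoc', div_le_one hN0]
    nlinarith [le_abs_self m]
  have hBη : B * (v b - v a) * η ≤ 1 := by
    rw [hη, mul_div_assoc', div_le_one hN0]
    linarith
  let τ : ℕ → ℝ := fun i => a + i * η
  have hτN : τ N = b := by simp only [τ, η]; field_simp; ring
  have hτs : ∀ i, τ (i + 1) - τ i = η := fun i => by simp only [τ]; push_cast; ring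
  have hτ0 : τ 0 = a := by simp [τ]
  have hτmem : ∀ i, i ≤ N → τ i ∈ Icc a b := fun i hi => by
    refine ⟨by simp only [τ]; linarith [show 0 ≤ i * η by positivity], ?_⟩
    rw [← hτN]
    simp only [τ]
    gcongr
  -- the factor `e^{-Θ}` turns the multiplicative recursion into a telescoping additive one
  let Θ : ℕ → ℝ := fun i => F (τ i) + B * η * v (τ i)
  have hrec : ∀ k, k ≤ N → Real.exp (-Θ k) * W (τ k) ≤ Real.exp (-Θ 0) * W (τ 0)
      + ∑ i ∈ Finset.range k, Real.exp (-Θ i) * (D * Real.exp 1 * η) := by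
    intro k
    induction k with
    | zero => intro _; simp
    | succ k ih =>
      intro hk
      have h1 := hstep (τ k) (hτmem k (by omega)) (τ (k + 1)) (hτmem _ hk) (by linarith [hτs k])
      rw [hτs k] at h1
      have h2 : Real.exp (-Θ (k + 1)) * W (τ (k + 1)) ≤ Real.exp (-Θ k)
          * (W (τ k) + D * Real.exp (m * η) * η) := by
        calc _ ≤ Real.exp (-Θ (k + 1)) * (Real.exp (F (τ (k + 1)) - F (τ k)
              + B * (v (τ (k + 1)) - v (τ k)) * η) * (W (τ k) + D * Real.exp (m * η) * η)) := by
              gcongr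
          _ = _ := by
              rw [← mul_assoc, ← Real.exp_add]
              congr 2
              simp only [Θ]; ring
      rw [Finset.sum_range_succ]
      have h3 : D * Real.exp (m * η) * η ≤ D * Real.exp 1 * η := by gcongr
      have h4 := mul_le_mul_of_nonneg_left h3 (Real.exp_pos (-Θ k)).le
      have := ih (by omega)
      rw [mul_add] at h2
      linarith
  have hΘ : ∀ i, i ≤ N → Real.exp (Θ N) * Real.exp (-Θ i)
      ≤ Real.exp (K + 1) * Real.exp (-μ * (b - τ i)) := by
    intro i hi
    have hi' := hτmem i hi
    rw [← Real.exp_add, ← Real.exp_add]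
    refine Real.exp_le_exp.2 ?_
    have h1 := hF (τ i) hi'
    have h2 : B * η * (v b - v (τ i)) ≤ 1 := by
      have : v a ≤ v (τ i) := hv ⟨le_rfl, hab⟩ hi' hi'.1
      have h3 : B * η * (v b - v (τ i)) ≤ B * η * (v b - v a) := by gcongr
      linarith
    simp only [Θ, hτN]
    linarith
  have hsum : ∀ k, ∑ i ∈ Finset.range k, Real.exp (-μ * (b - τ i)) * η
      ≤ Real.exp (-μ * (b - τ k)) / μ := by
    intro k
    induction k with
    | zero => simp; positivity
    | succ k ih =>
      rw [Finset.sum_range_succ]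
      have h1 : Real.exp (-μ * (b - τ (k + 1))) = Real.exp (-μ * (b - τ k)) * Real.exp (μ * η) := by
        rw [← Real.exp_add, ← hτs k]; ring_nf
      have h2 := Real.add_one_le_exp (μ * η)
      rw [h1, le_div_iff₀ hμ]
      rw [le_div_iff₀ hμ] at ih
      nlinarith [Real.exp_pos (-μ * (b - τ k))]
  have hmain := mul_le_mul_of_nonneg_left (hrec N le_rfl) (Real.exp_pos (Θ N)).le
  rw [← mul_assoc, ← Real.exp_add, add_neg_cancel, Real.exp_zero, one_mul, hτN, mul_add,
    Finset.mul_sum] at hmain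
  refine hmain.trans ?_
  rw [mul_add]
  refine add_le_add ?_ ?_
  · rw [← mul_assoc, ← mul_assoc, hτ0]
    have h0 := hΘ 0 (by omega)
    rw [hτ0] at h0
    exact mul_le_mul_of_nonneg_right h0 (hW a ⟨le_rfl, hab⟩)
  · calc _ ≤ ∑ i ∈ Finset.range N, Real.exp (K + 1) * (D * Real.exp 1)
            * (Real.exp (-μ * (b - τ i)) * η) := by
          refine Finset.sum_le_sum fun i hi => ?_
          have := mul_le_mul_of_nonneg_right (hΘ i (Finset.mem_range.1 hi).le)
            (show 0 ≤ D * Real.exp 1 * η by positivity)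
          calc _ = Real.exp (Θ N) * Real.exp (-Θ i) * (D * Real.exp 1 * η) := by ring
            _ ≤ _ := this
            _ = _ := by ring
      _ = Real.exp (K + 1) * (D * Real.exp 1)
            * ∑ i ∈ Finset.range N, Real.exp (-μ * (b - τ i)) * η := by rw [Finset.mul_sum]
      _ ≤ Real.exp (K + 1) * (D * Real.exp 1) * (Real.exp (-μ * (b - τ N)) / μ) := by
          gcongr; exact hsum N
      _ = _ := by rw [hτN]; simp; ring

/-! ### Regularity of the spectral abscissa along the trajectory -/

lemma AbsContOnIoo.continuousAt {X : Type*} [PseudoMetricSpace X] {f : ℝ → X} {a b t : ℝ}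
    (hf : AbsContOnIoo f a b) (ht : t ∈ Ioo a b) : ContinuousAt f t := by
  rw [Metric.continuousAt_iff']
  intro ε hε
  obtain ⟨δ, hδ, h⟩ := hf ε hε
  filter_upwards [isOpen_Ioo.mem_nhds ht, Metric.ball_mem_nhds t hδ] with r hr hrδ
  have h1 := h 1 (fun _ => min r t) (fun _ => max r t)
    (fun _ _ => ⟨lt_min hr.1 ht.1, min_le_max, max_lt hr.2 ht.2⟩)
    (fun i hi j hj hij => absurd (by omega) hij)
    (by
      rw [Metric.mem_ball, Real.dist_eq] at hrδ
      simpa [max_sub_min_eq_abs'] using hrδ)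
  simp only [Finset.sum_range_one] at h1
  rcases le_total r t with hrt | hrt
  · simpa [hrt] using h1
  · simpa [hrt, dist_comm] using h1

lemma PiecewiseRegular.continuousAt_abscissa {n : ℕ} {A : ℝ → Matrix (Fin n) (Fin n) ℝ}
    (hA : PiecewiseRegular A) {t : ℝ} (ht : 0 < t) (hj : t ∉ jumpTimes A) :
    ContinuousAt (fun t => spectralAbscissa (A t)) t := by
  have hfin := hA.finite_jumps 0 (t + 1) le_rfl (by linarith)
  have hnhds : (jumpTimes A ∩ Ioo 0 (t + 1))ᶜ ∩ Ioo 0 (t + 1) ∈ 𝓝 t :=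
    inter_mem (hfin.isClosed.isOpen_compl.mem_nhds fun h => hj h.1)
      (isOpen_Ioo.mem_nhds ⟨ht, by linarith⟩)
  obtain ⟨a, b, hab, hsub⟩ := mem_nhds_iff_exists_Ioo_subset.1 hnhds
  have ha : max a 0 < b := max_lt (hab.1.trans hab.2) (ht.trans hab.2)
  refine (hA.absCont_abscissa (max a 0) b (le_max_right _ _) ha ?_).continuousAt
    ⟨max_lt hab.1 ht, hab.2⟩
  refine eq_empty_iff_forall_notMem.2 fun r hr => ?_
  have h2 := hsub ⟨(le_max_left _ _).trans_lt hr.2.1, hr.2.2⟩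
  exact h2.1 ⟨hr.1, h2.2⟩

lemma phi_nonneg {n : ℕ} (κ : ℝ) (M : Matrix (Fin n) (Fin n) ℝ) : 0 ≤ phi κ M := le_max_right _ _

lemma BoundedTrajectory.phi_le {n : ℕ} {A : ℝ → Matrix (Fin n) (Fin n) ℝ} {L αmax : ℝ}
    (hA : BoundedTrajectory A L αmax) (κ : ℝ) {t : ℝ} (ht : 0 ≤ t) :
    phi κ (A t) ≤ ramp (αmax + κ) :=
  max_le_max_right _ (by linarith [hA.abscissa_le t ht])

/-- The shift `φ_κ(A(t))` is continuous off the finitely many jumps, hence integrable. -/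
lemma PiecewiseRegular.intervalIntegrable_phi {n : ℕ} {A : ℝ → Matrix (Fin n) (Fin n) ℝ}
    {L αmax κ : ℝ} (hA : PiecewiseRegular A) (hbd : BoundedTrajectory A L αmax) {s t : ℝ}
    (hs : 0 ≤ s) (hst : s ≤ t) : IntervalIntegrable (fun r => phi κ (A r)) volume s t := by
  rcases hst.eq_or_lt with rfl | hlt
  · exact IntervalIntegrable.refl
  rw [intervalIntegrable_iff_integrableOn_Ioo_of_le hst]
  have hfin := hA.finite_jumps s t hs hlt
  have hcont : ContinuousOn (fun r => phi κ (A r)) (Ioo s t \ (jumpTimes A ∩ Ioo s t)) := by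
    intro r hr
    have := hA.continuousAt_abscissa (hs.trans_lt hr.1.1) fun h => hr.2 ⟨h, hr.1⟩
    have hc : Continuous fun a : ℝ => max (a + κ) 0 := by fun_prop
    exact (hc.continuousAt.comp (f := fun t => spectralAbscissa (A t)) this).continuousWithinAt
  have hae : (Ioo s t \ (jumpTimes A ∩ Ioo s t) : Set ℝ) =ᵐ[volume] Ioo s t :=
    sdiff_null_ae_eq_self (hfin.measure_zero volume)
  refine IntegrableOn.congr_set_ae ?_ hae.symm
  have hS : MeasurableSet (Ioo s t \ (jumpTimes A ∩ Ioo s t)) :=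
    measurableSet_Ioo.diff hfin.measurableSet
  refine ⟨hcont.aestronglyMeasurable hS, .restrict_of_bounded (C := ramp (αmax + κ))
    ((measure_mono sdiff_subset).trans_lt measure_Ioo_lt_top)
    ((ae_restrict_mem hS).mono fun r hr => ?_)⟩
  rw [Real.norm_of_nonneg (phi_nonneg _ _)]
  exact hbd.phi_le κ (hs.trans hr.1.1.le)

/-! ### The Lyapunov function along solutions -/

section Trajectory

open InnerProductSpace

/-- The derivative of the Lyapunov function of a frozen generator `T` along
`ẋ = T' x + φ x + w`. The source term is split off by `2 c₂ δ |x| ≤ ε |x|² + c₂² δ² / ε`. -/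
lemma inner_lyapunovOp_deriv_le {E : Type*} [NormedAddCommGroup E] [InnerProductSpace ℝ E]
    [CompleteSpace E] {T T' : E →L[ℝ] E} {β c c₁ φ γ δ η ε : ℝ} {x w : E}
    (hT : ExpDecay β c T) (hβ : 0 < β) (hc : 0 < c) (hc₁ : 0 < c₁) (hε : 0 < ε) (hγ : 0 ≤ γ)
    (hlow : c₁ * ‖x‖ ^ 2 ≤ ⟪lyapunovOp T x, x⟫_ℝ) (hη : ‖T' - T‖ ≤ η)
    (hw : ‖w‖ ≤ γ * ‖x‖ + δ) :
    2 * ⟪lyapunovOp T x, T' x + φ • x + w⟫_ℝ ≤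
      (-(1 / upperConst c β) + 2 * φ + 2 * upperConst c β / c₁ * γ + ε / c₁
        + 2 * upperConst c β / c₁ * η) * ⟪lyapunovOp T x, x⟫_ℝ
      + upperConst c β ^ 2 * δ ^ 2 / ε := by
  set P := lyapunovOp T
  set c₂ := upperConst c β with hc₂def
  have hc₂ : 0 < c₂ := by rw [hc₂def, upperConst]; positivity
  set V := ⟪P x, x⟫_ℝ
  have hPx : ‖P x‖ ≤ c₂ * ‖x‖ :=
    (P.le_opNorm x).trans (by gcongr; exact norm_lyapunovOp_le hT hβ)
  have hup : V ≤ c₂ * ‖x‖ ^ 2 := inner_lyapunovOp_le hT hβ x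
  have heq : 2 * ⟪P x, T x⟫_ℝ = -‖x‖ ^ 2 := lyapunov_equation hT hβ x
  have hη0 : 0 ≤ η := (norm_nonneg _).trans hη
  have h1 : ⟪P x, (T' - T) x⟫_ℝ ≤ c₂ * η * ‖x‖ ^ 2 := by
    calc _ ≤ ‖P x‖ * ‖(T' - T) x‖ := real_inner_le_norm _ _
      _ ≤ (c₂ * ‖x‖) * (η * ‖x‖) := by
        gcongr
        exact ((T' - T).le_opNorm x).trans (by gcongr)
      _ = _ := by ring
  have h2 : ⟪P x, w⟫_ℝ ≤ c₂ * γ * ‖x‖ ^ 2 + c₂ * δ * ‖x‖ := by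
    calc _ ≤ ‖P x‖ * ‖w‖ := real_inner_le_norm _ _
      _ ≤ (c₂ * ‖x‖) * (γ * ‖x‖ + δ) := by gcongr
      _ = _ := by ring
  have h3 : 2 * (c₂ * δ * ‖x‖) ≤ ε * ‖x‖ ^ 2 + c₂ ^ 2 * δ ^ 2 / ε := by
    have : ε * ‖x‖ ^ 2 + c₂ ^ 2 * δ ^ 2 / ε - 2 * (c₂ * δ * ‖x‖)
        = (ε * ‖x‖ - c₂ * δ) ^ 2 / ε := by field_simp; ring
    have := div_nonneg (sq_nonneg (ε * ‖x‖ - c₂ * δ)) hε.le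
    linarith
  have hsplit : ⟪P x, T' x + φ • x + w⟫_ℝ
      = ⟪P x, T x⟫_ℝ + ⟪P x, (T' - T) x⟫_ℝ + φ * V + ⟪P x, w⟫_ℝ := by
    rw [inner_add_right, inner_add_right, inner_smul_right, sub_apply, inner_sub_right]
    simp [V]
  have h4 : 1 / c₂ * V ≤ ‖x‖ ^ 2 := by
    rw [one_div_mul_eq_div, div_le_iff₀ hc₂]; linarith
  have h5 : (2 * c₂ * γ + ε + 2 * c₂ * η) * ‖x‖ ^ 2
      ≤ (2 * c₂ * γ + ε + 2 * c₂ * η) * (V / c₁) := by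
    refine mul_le_mul_of_nonneg_left ?_ (by positivity)
    rw [le_div_iff₀ hc₁]; linarith
  have h6 : (2 * c₂ * γ + ε + 2 * c₂ * η) * (V / c₁)
      = (2 * c₂ / c₁ * γ + ε / c₁ + 2 * c₂ / c₁ * η) * V := by field_simp
  rw [hsplit]
  linarith

variable {n : ℕ}

/-- The operator `Ã = A - φ_κ(A) I` on Euclidean space. -/
noncomputable def shiftedCLM (κ : ℝ) (M : Matrix (Fin n) (Fin n) ℝ) :
    EuclideanSpace ℝ (Fin n) →L[ℝ] EuclideanSpace ℝ (Fin n) :=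
  Matrix.toEuclideanCLM (𝕜 := ℝ) (shifted κ M)

lemma DecayBound.expDecay {κ β c : ℝ} {M : Matrix (Fin n) (Fin n) ℝ} (h : DecayBound κ β c M) :
    ExpDecay β c (shiftedCLM κ M) := by
  intro s hs
  have hcont : Continuous (Matrix.toEuclideanCLM (n := Fin n) (𝕜 := ℝ)) :=
    (LinearMap.toContinuousLinearMap
      (Matrix.toEuclideanCLM (n := Fin n) (𝕜 := ℝ)).toAlgEquiv.toLinearMap).continuous
  let _ : NormedAlgebra ℚ (Matrix (Fin n) (Fin n) ℝ) := .restrictScalars ℚ ℝ _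
  rw [shiftedCLM, ← map_smul, ← NormedSpace.map_exp _ hcont, Matrix.l2_opNorm_toEuclideanCLM]
  exact h s hs

lemma norm_shiftedCLM_sub (κ : ℝ) (M N : Matrix (Fin n) (Fin n) ℝ) :
    ‖shiftedCLM κ M - shiftedCLM κ N‖ = ‖shifted κ M - shifted κ N‖ := by
  rw [shiftedCLM, shiftedCLM, ← map_sub, Matrix.l2_opNorm_toEuclideanCLM]

lemma shiftedCLM_apply_add (κ : ℝ) (M : Matrix (Fin n) (Fin n) ℝ)
    (x : EuclideanSpace ℝ (Fin n)) :
    shiftedCLM κ M x + phi κ M • x = WithLp.toLp 2 (M.mulVec (WithLp.ofLp x)) := by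
  rw [shiftedCLM, shifted, map_sub, map_smul, map_one]
  simp [← Matrix.toEuclideanCLM_toLp]

lemma BoundedTrajectory.norm_shiftedCLM_le {A : ℝ → Matrix (Fin n) (Fin n) ℝ} {L αmax : ℝ}
    (hA : BoundedTrajectory A L αmax) (κ : ℝ) {t : ℝ} (ht : 0 ≤ t) :
    ‖shiftedCLM κ (A t)‖ ≤ L + ramp (αmax + κ) := by
  rw [shiftedCLM, shifted, map_sub, map_smul, map_one]
  refine (norm_sub_le _ _).trans (add_le_add (hA.norm_le t ht) ?_)
  rw [norm_smul, Real.norm_of_nonneg (phi_nonneg _ _)]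
  calc _ ≤ phi κ (A t) * 1 :=
        mul_le_mul_of_nonneg_left ContinuousLinearMap.norm_id_le (phi_nonneg _ _)
    _ ≤ _ := by rw [mul_one]; exact hA.phi_le κ ht

lemma BoundedTrajectory.lowerConst_pos {A : ℝ → Matrix (Fin n) (Fin n) ℝ} {L αmax : ℝ}
    (hA : BoundedTrajectory A L αmax) (κ : ℝ) : 0 < lowerConst L αmax κ := by
  have := hA.pos
  have h : 0 ≤ ramp (αmax + κ) := le_max_right _ _
  rw [lowerConst]; positivity

/-- The time-varying quadratic Lyapunov function `V(t, x) = ⟪P(t) x, x⟫`. -/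
noncomputable def lyapunovFun (κ : ℝ) (A : ℝ → Matrix (Fin n) (Fin n) ℝ) (t : ℝ)
    (x : EuclideanSpace ℝ (Fin n)) : ℝ :=
  ⟪lyapunovOp (shiftedCLM κ (A t)) x, x⟫_ℝ

lemma BoundedTrajectory.lowerConst_mul_le {A : ℝ → Matrix (Fin n) (Fin n) ℝ}
    {L αmax κ β c : ℝ} (hA : BoundedTrajectory A L αmax) (hβ : 0 < β) {t : ℝ} (ht : 0 ≤ t)
    (hdec : DecayBound κ β c (A t)) (x : EuclideanSpace ℝ (Fin n)) :
    lowerConst L αmax κ * ‖x‖ ^ 2 ≤ lyapunovFun κ A t x := by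
  have h := norm_sq_le_inner_lyapunovOp hdec.expDecay hβ x
  have hV := inner_lyapunovOp_nonneg hdec.expDecay hβ x
  have hn := hA.norm_shiftedCLM_le κ ht
  have hpos := hA.lowerConst_pos κ
  rw [lowerConst] at hpos ⊢
  rw [one_div_mul_eq_div, div_le_iff₀ (one_div_pos.1 hpos), lyapunovFun, mul_comm]
  exact h.trans (by gcongr)

lemma dist_shifted_le_eVariationOn {A : ℝ → Matrix (Fin n) (Fin n) ℝ} {κ s t r : ℝ}
    (hfin : eVariationOn (fun t => shifted κ (A t)) (Icc s t) ≠ ⊤) (hr : r ∈ Icc s t)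
    {r' : ℝ} (hr' : r' ∈ Icc s t) :
    ‖shiftedCLM κ (A r) - shiftedCLM κ (A r')‖
      ≤ (eVariationOn (fun t => shifted κ (A t)) (Icc s t)).toReal := by
  rw [norm_shiftedCLM_sub, ← dist_eq_norm]
  exact BoundedVariationOn.dist_le hfin hr hr'

/-- The growth rate of the Lyapunov function apart from the contribution of the variation of `Ã`.
The summand `μ` is the part of the decay rate given up to absorb the source term. -/
noncomputable def growthRate (κ μ c₁ c₂ : ℝ) (A : ℝ → Matrix (Fin n) (Fin n) ℝ) (γ : ℝ → ℝ)
    (r : ℝ) : ℝ :=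
  -(1 / c₂) + μ + 2 * phi κ (A r) + 2 * c₂ / c₁ * γ r

/-- One step of the comparison argument on `[s, t]`: Grönwall for the Lyapunov function frozen at
time `s`, followed by the change of the Lyapunov function from time `s` to time `t`. Both errors
are controlled by the variation of `Ã` on `[s, t]`. -/
lemma lyapunovFun_step {A : ℝ → Matrix (Fin n) (Fin n) ℝ}
    {g : ℝ → EuclideanSpace ℝ (Fin n) → EuclideanSpace ℝ (Fin n)} {γ δ : ℝ → ℝ}
    {L αmax κ β c : ℝ} (hβ : 0 < β) (hA : BoundedTrajectory A L αmax) (hreg : PiecewiseRegular A)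
    (hg : AdmissiblePerturbation g γ δ) (hc : 0 < c)
    (hdec : ∀ t : ℝ, 0 ≤ t → DecayBound κ β c (A t))
    {t₀ T : ℝ} {x₀ : EuclideanSpace ℝ (Fin n)} {x : ℝ → EuclideanSpace ℝ (Fin n)}
    (hx : IsSolution A g t₀ T x₀ x) (ht₀ : 0 ≤ t₀) {s t : ℝ} (h0s : t₀ ≤ s) (hst : s ≤ t)
    (htT : t ≤ T) (hfin : eVariationOn (fun t => shifted κ (A t)) (Icc s t) ≠ ⊤)
    {Δ μ : ℝ} (hΔ : ∀ r ∈ Icc s t, δ r ≤ Δ) (hμ : 0 < μ) {v : ℝ}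
    (hv : v = (eVariationOn (fun t => shifted κ (A t)) (Icc s t)).toReal) :
    lyapunovFun κ A t (x t) ≤ Real.exp
        ((∫ r in s..t, growthRate κ μ (lowerConst L αmax κ) (upperConst c β) A γ r)
          + 2 * upperConst c β ^ 2 / lowerConst L αmax κ * v
          + 2 * upperConst c β / lowerConst L αmax κ * v * (t - s))
      * (lyapunovFun κ A s (x s)
          + upperConst c β ^ 2 * Δ ^ 2 / (lowerConst L αmax κ * μ)
            * Real.exp (1 / upperConst c β * (t - s)) * (t - s)) := by
  have hs0 : 0 ≤ s := ht₀.trans h0s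
  have hc₁ := hA.lowerConst_pos κ
  have hlow := fun y => hA.lowerConst_mul_le hβ hs0 (hdec s hs0) y
  have hTs := (hdec s hs0).expDecay
  set c₁ := lowerConst L αmax κ
  set c₂ := upperConst c β with hc₂def
  have hc₂ : 0 < c₂ := by rw [hc₂def, upperConst]; positivity
  set P := lyapunovOp (shiftedCLM κ (A s))
  have hv0 : 0 ≤ v := by rw [hv]; positivity
  set D := c₂ ^ 2 * Δ ^ 2 / (c₁ * μ)
  -- replacing the frozen Lyapunov function by the current one costs a factor `e^{ω v}`
  have hswitch : lyapunovFun κ A t (x t)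
      ≤ Real.exp (2 * c₂ ^ 2 / c₁ * v) * lyapunovFun κ A s (x t) := by
    have h1 := inner_lyapunovOp_le_mul hTs (hdec t (hs0.trans hst)).expDecay hβ (x t)
    have h2 := dist_shifted_le_eVariationOn hfin (left_mem_Icc.2 hst) (right_mem_Icc.2 hst)
    rw [← hv] at h2
    have hup : lyapunovFun κ A s (x t) ≤ c₂ * ‖x t‖ ^ 2 := inner_lyapunovOp_le hTs hβ _
    have hV0 : 0 ≤ lyapunovFun κ A s (x t) := inner_lyapunovOp_nonneg hTs hβ _
    have h3 : lyapunovFun κ A s (x t) ≤ c₂ / c₁ * lyapunovFun κ A s (x t) := by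
      rw [div_mul_eq_mul_div, le_div_iff₀ hc₁]
      nlinarith [hlow (x t)]
    have h4 : 2 * c₂ * v * lyapunovFun κ A s (x t)
        ≤ 2 * c₂ * v * (c₂ / c₁ * lyapunovFun κ A s (x t)) := by gcongr
    have h5 := Real.add_one_le_exp (2 * c₂ ^ 2 / c₁ * v)
    calc _ ≤ (1 + 2 * c₂ * ‖shiftedCLM κ (A s) - shiftedCLM κ (A t)‖)
          * lyapunovFun κ A s (x t) := h1
      _ ≤ (1 + 2 * c₂ * v) * lyapunovFun κ A s (x t) := by gcongr
      _ ≤ (2 * c₂ ^ 2 / c₁ * v + 1) * lyapunovFun κ A s (x t) := by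
          have h6 : 2 * c₂ * v * (c₂ / c₁ * lyapunovFun κ A s (x t))
            = 2 * c₂ ^ 2 / c₁ * v * lyapunovFun κ A s (x t) := by field_simp
          linarith
      _ ≤ _ := by gcongr
  have hsub : Icc s t ⊆ Icc t₀ T := Icc_subset_Icc h0s htT
  have hxac : AbsolutelyContinuousOnInterval x s t := hx.absCont.mono (by
    rw [uIcc_of_le hst, uIcc_of_le (h0s.trans (hst.trans htT))]; exact hsub)
  have hqac : AbsolutelyContinuousOnInterval (fun r => lyapunovFun κ A s (x r)) s t := by
    refine hxac.contDiff_comp (ψ := fun y => lyapunovFun κ A s y) ?_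
    exact P.contDiff.inner ℝ contDiff_id
  have hφint := hreg.intervalIntegrable_phi (κ := κ) hA hs0 hst
  have hγint : IntervalIntegrable γ volume s t := by
    refine (hg.gamma_cont.mono ?_).intervalIntegrable
    rw [uIcc_of_le hst]
    exact fun r hr => hs0.trans hr.1
  have hrate : IntervalIntegrable (growthRate κ μ c₁ c₂ A γ) volume s t :=
    ((intervalIntegrable_const (c := -(1 / c₂) + μ)).add (hφint.const_mul 2)).add
      (hγint.const_mul (2 * c₂ / c₁))
  have hgron := gronwall_absolutelyContinuous (D := D) (m := 1 / c₂)
    (h := fun r => growthRate κ μ c₁ c₂ A γ r + 2 * c₂ / c₁ * v) hst hqac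
    (hrate.add intervalIntegrable_const) (by positivity) (by positivity) ?_ ?_
  · rw [intervalIntegral.integral_add hrate intervalIntegrable_const,
      intervalIntegral.integral_const] at hgron
    refine hswitch.trans ((mul_le_mul_of_nonneg_left hgron (Real.exp_pos _).le).trans_eq ?_)
    rw [← mul_assoc, ← Real.exp_add, smul_eq_mul]
    congr 2
    ring
  · intro r hr
    have h1 := hg.gamma_nonneg r (hs0.trans hr.1)
    have h2 := phi_nonneg κ (A r)
    have h3 : 0 ≤ 2 * c₂ / c₁ * γ r := by positivity
    have h4 : 0 ≤ 2 * c₂ / c₁ * v := by positivity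
    simp only [growthRate]
    linarith
  · filter_upwards [hx.ode] with r hr hrst
    have hr0 : 0 ≤ r := hs0.trans hrst.1.le
    have hrI : r ∈ Icc s t := Ioo_subset_Icc_self hrst
    have hxr := hr ⟨h0s.trans_lt hrst.1, hrst.2.trans_le htT⟩
    have hd : HasDerivAt (fun r => lyapunovFun κ A s (x r))
        (2 * ⟪P (x r), shiftedCLM κ (A r) (x r) + phi κ (A r) • x r + g r (x r)⟫_ℝ) r := by
      rw [shiftedCLM_apply_add]
      refine ((P.hasFDerivAt.comp_hasDerivAt r hxr).inner ℝ hxr).congr_deriv ?_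
      set w := WithLp.toLp 2 ((A r).mulVec (x r).ofLp) + g r (x r)
      change ⟪P (x r), w⟫_ℝ + ⟪P w, x r⟫_ℝ = 2 * ⟪P (x r), w⟫_ℝ
      rw [lyapunovOp_symm hTs hβ w, real_inner_comm (P (x r)) w, two_mul]
    refine ⟨_, hd, ?_⟩
    have hv' := dist_shifted_le_eVariationOn hfin hrI (left_mem_Icc.2 hst)
    rw [← hv] at hv'
    have hw : ‖g r (x r)‖ ≤ γ r * ‖x r‖ + Δ :=
      (hg.norm_le r hr0 (x r)).trans (by linarith [hΔ r hrI])
    refine (inner_lyapunovOp_deriv_le (φ := phi κ (A r)) hTs hβ hc hc₁ (mul_pos hc₁ hμ)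
      (hg.gamma_nonneg r hr0) (hlow (x r)) hv' hw).trans_eq ?_
    simp only [growthRate, ← hc₂def, lyapunovFun, D]
    rw [mul_div_cancel_left₀ μ hc₁.ne']
    ring

end Trajectory

/-! ### The mixed condition and the stability estimate -/

/-- The mixed condition as a real inequality; the variation of `Ã` is finite since its coefficient
is positive. -/
lemma MixedCondition.real_le {n : ℕ} {A : ℝ → Matrix (Fin n) (Fin n) ℝ} {γ : ℝ → ℝ}
    {κ c₁ c₂ lam ρ : ℝ} (h : MixedCondition A γ κ c₁ c₂ lam ρ) (hc₂ : 0 < c₂) {s t : ℝ}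
    (hs : 0 ≤ s) (hst : s ≤ t) :
    eVariationOn (fun t => shifted κ (A t)) (Icc s t) ≠ ⊤ ∧
      c₁ * (∫ τ in s..t, phi κ (A τ)) + c₂ * (∫ τ in s..t, γ τ)
        + c₂ ^ 2 * (eVariationOn (fun t => shifted κ (A t)) (Icc s t)).toReal
        ≤ lam * (t - s) + ρ := by
  have h1 := h s t hs hst
  have hfin : eVariationOn (fun t => shifted κ (A t)) (Icc s t) ≠ ⊤ := by
    intro htop
    rw [htop, EReal.coe_ennreal_top, EReal.coe_mul_top_of_pos (by positivity),
      EReal.coe_add_top] at h1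
    exact EReal.coe_ne_top _ (top_le_iff.1 h1)
  refine ⟨hfin, ?_⟩
  rw [← EReal.coe_ennreal_toReal hfin, ← EReal.coe_mul, ← EReal.coe_add] at h1
  exact EReal.coe_le_coe_iff.1 h1

lemma toReal_eVariationOn_Icc_add {X : Type*} [PseudoEMetricSpace X] {f : ℝ → X} {a b c : ℝ}
    (hab : a ≤ b) (hbc : b ≤ c) (hfin : eVariationOn f (Icc a c) ≠ ⊤) :
    (eVariationOn f (Icc a b)).toReal + (eVariationOn f (Icc b c)).toReal
      = (eVariationOn f (Icc a c)).toReal := by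
  have h := eVariationOn.Icc_add_Icc f (s := univ) hab hbc (mem_univ b)
  simp only [univ_inter] at h
  rw [← h, ENNReal.toReal_add]
  · exact ne_top_of_le_ne_top hfin (eVariationOn.mono f (Icc_subset_Icc_right hbc))
  · exact ne_top_of_le_ne_top hfin (eVariationOn.mono f (Icc_subset_Icc_left hab))

/-- The Lyapunov function decays exponentially along solutions, up to the size of the source. -/
lemma lyapunovFun_le {n : ℕ} {A : ℝ → Matrix (Fin n) (Fin n) ℝ}
    {g : ℝ → EuclideanSpace ℝ (Fin n) → EuclideanSpace ℝ (Fin n)} {γ δ : ℝ → ℝ}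
    {L αmax κ β c lam ρ : ℝ} (hβ : 0 < β) (hA : BoundedTrajectory A L αmax)
    (hreg : PiecewiseRegular A) (hg : AdmissiblePerturbation g γ δ) (hc : 0 < c)
    (hdec : ∀ t : ℝ, 0 ≤ t → DecayBound κ β c (A t))
    (hmix : MixedCondition A γ κ (lowerConst L αmax κ) (upperConst c β) lam ρ)
    {μ : ℝ} (hμ : 0 < μ)
    (hμeq : 2 * μ = 1 / upperConst c β - 2 * lam / lowerConst L αmax κ)
    {t₀ T : ℝ} {x₀ : EuclideanSpace ℝ (Fin n)} {x : ℝ → EuclideanSpace ℝ (Fin n)}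
    (hx : IsSolution A g t₀ T x₀ x) (ht₀ : 0 ≤ t₀) {t : ℝ} (ht : t ∈ Icc t₀ T)
    {Δ : ℝ} (hΔ : ∀ r ∈ Icc t₀ t, δ r ≤ Δ) :
    lyapunovFun κ A t (x t) ≤ Real.exp (2 * ρ / lowerConst L αmax κ + 1)
      * (Real.exp (-μ * (t - t₀)) * lyapunovFun κ A t₀ x₀
        + upperConst c β ^ 2 * Δ ^ 2 / (lowerConst L αmax κ * μ) * Real.exp 1 / μ) := by
  have hc₁ := hA.lowerConst_pos κ
  set c₁ := lowerConst L αmax κ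
  set c₂ := upperConst c β with hc₂def
  have hc₂ : 0 < c₂ := by rw [hc₂def, upperConst]; positivity
  have hmr := fun {s t : ℝ} (hs : 0 ≤ s) (hst : s ≤ t) => hmix.real_le hc₂ hs hst
  let v : ℝ → ℝ := fun r => (eVariationOn (fun t => shifted κ (A t)) (Icc 0 r)).toReal
  have hvsub : ∀ {s r : ℝ}, 0 ≤ s → s ≤ r →
      v r - v s = (eVariationOn (fun t => shifted κ (A t)) (Icc s r)).toReal := fun hs hr => by
    rw [sub_eq_iff_eq_add']
    exact (toReal_eVariationOn_Icc_add hs hr (hmr le_rfl (hs.trans hr)).1).symm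
  have hφint := fun {s r : ℝ} (hs : 0 ≤ s) (hsr : s ≤ r) =>
    hreg.intervalIntegrable_phi (κ := κ) hA hs hsr
  have hγint : ∀ {s r : ℝ}, 0 ≤ s → s ≤ r → IntervalIntegrable γ volume s r := by
    intro s r hs hsr
    refine (hg.gamma_cont.mono ?_).intervalIntegrable
    rw [uIcc_of_le hsr]
    exact fun u hu => hs.trans hu.1
  have hrate : ∀ {s r : ℝ}, 0 ≤ s → s ≤ r →
      IntervalIntegrable (growthRate κ μ c₁ c₂ A γ) volume s r := fun hs hsr =>
    ((intervalIntegrable_const (c := -(1 / c₂) + μ)).add ((hφint hs hsr).const_mul 2)).add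
      ((hγint hs hsr).const_mul (2 * c₂ / c₁))
  let F : ℝ → ℝ := fun r => (∫ u in (0 : ℝ)..r, growthRate κ μ c₁ c₂ A γ u) + 2 * c₂ ^ 2 / c₁ * v r
  have hFsub : ∀ {s r : ℝ}, 0 ≤ s → s ≤ r →
      F r - F s = (∫ u in s..r, growthRate κ μ c₁ c₂ A γ u) + 2 * c₂ ^ 2 / c₁ * (v r - v s) :=
    fun {s r} hs hsr => by
      have := intervalIntegral.integral_add_adjacent_intervals (hrate le_rfl hs) (hrate hs hsr)
      simp only [F]
      linarith
  have hinit : x t₀ = x₀ := hx.init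
  rw [← hinit]
  refine le_of_local_gronwall (W := fun r => lyapunovFun κ A r (x r)) (F := F) (v := v)
    (B := 2 * c₂ / c₁) (m := 1 / c₂) ht.1 ?_ ?_ (by positivity) (by positivity) hμ ?_ ?_
  · exact fun s hs => inner_lyapunovOp_nonneg (hdec s (ht₀.trans hs.1)).expDecay hβ _
  · intro s hs r _ hsr
    rw [← sub_nonneg, hvsub (ht₀.trans hs.1) hsr]
    exact ENNReal.toReal_nonneg
  · intro s hs
    have hs0 := ht₀.trans hs.1
    rw [hFsub hs0 hs.2, hvsub hs0 hs.2]
    have hint : ∫ u in s..t, growthRate κ μ c₁ c₂ A γ u = (t - s) * (-(1 / c₂) + μ)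
        + 2 * (∫ u in s..t, phi κ (A u)) + 2 * c₂ / c₁ * ∫ u in s..t, γ u := by
      simp only [growthRate]
      rw [intervalIntegral.integral_add, intervalIntegral.integral_add,
        intervalIntegral.integral_const, intervalIntegral.integral_const_mul,
        intervalIntegral.integral_const_mul, smul_eq_mul]
      · exact intervalIntegrable_const
      · exact (hφint hs0 hs.2).const_mul 2
      · exact intervalIntegrable_const.add ((hφint hs0 hs.2).const_mul 2)
      · exact (hγint hs0 hs.2).const_mul _
    have hm := mul_le_mul_of_nonneg_left (hmr hs0 hs.2).2 (show 0 ≤ 2 / c₁ by positivity)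
    set I := ∫ u in s..t, phi κ (A u)
    set J := ∫ u in s..t, γ u
    set τ := (eVariationOn (fun t => shifted κ (A t)) (Icc s t)).toReal
    have e1 : 2 / c₁ * (c₁ * I + c₂ * J + c₂ ^ 2 * τ)
        = 2 * I + 2 * c₂ / c₁ * J + 2 * c₂ ^ 2 / c₁ * τ := by field_simp
    have e2 : 2 / c₁ * (lam * (t - s) + ρ) = 2 * lam / c₁ * (t - s) + 2 * ρ / c₁ := by field_simp
    have e3 : 2 * lam / c₁ = 1 / c₂ - 2 * μ := by linarith
    rw [e1, e2, e3] at hm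
    rw [hint]
    linarith
  · intro s hs r hr hsr
    have hs0 := ht₀.trans hs.1
    have hst := lyapunovFun_step hβ hA hreg hg hc hdec hx ht₀ hs.1 hsr (hr.2.trans ht.2)
      (hmr hs0 hsr).1 (fun u hu => hΔ u ⟨hs.1.trans hu.1, hu.2.trans hr.2⟩) hμ (hvsub hs0 hsr)
    rw [hFsub hs0 hsr]
    exact hst

theorem theorem1 {n : ℕ} (A : ℝ → Matrix (Fin n) (Fin n) ℝ)
    (g : ℝ → EuclideanSpace ℝ (Fin n) → EuclideanSpace ℝ (Fin n)) (γ δ : ℝ → ℝ)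
    (L αmax κ β : ℝ) (hκ : 0 < κ) (hβ₀ : 0 < β) (hβκ : β < κ)
    (hA : BoundedTrajectory A L αmax) (hreg : PiecewiseRegular A)
    (hg : AdmissiblePerturbation g γ δ) :
    -- a constant `c` depending only on `n, L, αmax, κ, β` exists, so that `c₂` is well defined
    (∃ c : ℝ, 0 < c ∧ ∀ M : Matrix (Fin n) (Fin n) ℝ,
      ‖M‖ ≤ L → spectralAbscissa M ≤ αmax → DecayBound κ β c M) ∧
    -- and the stability estimate holds for every admissible `c`
    (∀ c : ℝ, 0 < c → (∀ t : ℝ, 0 ≤ t → DecayBound κ β c (A t)) →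
      ∀ lam ρ : ℝ, 0 < ρ →
        lam < lowerConst L αmax κ / (2 * upperConst c β) →
        MixedCondition A γ κ (lowerConst L αmax κ) (upperConst c β) lam ρ →
        ∃ k₁ k₂ k₃ : ℝ, 0 < k₁ ∧ 0 < k₂ ∧ 0 < k₃ ∧
          ∀ t₀ T : ℝ, 0 ≤ t₀ → t₀ ≤ T →
            ∀ (x₀ : EuclideanSpace ℝ (Fin n)) (x : ℝ → EuclideanSpace ℝ (Fin n)),
              IsSolution A g t₀ T x₀ x → ∀ t ∈ Icc t₀ T,
                ‖x t‖ ≤ k₁ * Real.exp (-k₂ * (t - t₀)) * ‖x₀‖ + k₃ * sSup (δ '' Icc t₀ t)) := by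
  refine ⟨?_, ?_⟩
  · obtain ⟨c, hc, h⟩ := exists_decayBound (n := n) (L := L) hβκ
    exact ⟨c, hc, fun M hM _ => h M hM⟩
  intro c hc hdec lam ρ _ hlam hmix
  have hc₁ := hA.lowerConst_pos κ
  have hlow := fun {t : ℝ} (ht : 0 ≤ t) y => hA.lowerConst_mul_le hβ₀ ht (hdec t ht) y
  have hup : ∀ {t : ℝ}, 0 ≤ t → ∀ y, lyapunovFun κ A t y ≤ upperConst c β * ‖y‖ ^ 2 :=
    fun ht y => inner_lyapunovOp_le (hdec _ ht).expDecay hβ₀ y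
  have hkey := fun {μ : ℝ} (hμ : 0 < μ) h => @lyapunovFun_le n A g γ δ L αmax κ β c lam ρ hβ₀ hA
    hreg hg hc hdec hmix μ hμ h
  set c₁ := lowerConst L αmax κ
  set c₂ := upperConst c β with hc₂def
  have hc₂ : 0 < c₂ := by rw [hc₂def, upperConst]; positivity
  set μ : ℝ := (1 / c₂ - 2 * lam / c₁) / 2 with hμdef
  have hμ : 0 < μ := by
    rw [lt_div_iff₀ (by positivity)] at hlam
    have : 2 * lam / c₁ < 1 / c₂ := by
      rw [div_lt_div_iff₀ hc₁ hc₂]; linarith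
    rw [hμdef]; linarith
  set K := Real.exp (2 * ρ / c₁ + 1)
  have hK : 0 < K := Real.exp_pos _
  refine ⟨√(K * c₂ / c₁), μ / 2, √(K * Real.exp 1) * c₂ / (c₁ * μ), by positivity, by positivity,
    by positivity, ?_⟩
  intro t₀ T ht₀ _ x₀ x hx t ht
  set Δ := sSup (δ '' Icc t₀ t)
  have hbdd : BddAbove (δ '' Icc t₀ t) :=
    (isCompact_Icc.image_of_continuousOn (hg.delta_cont.mono fun r hr => ht₀.trans hr.1)).bddAbove
  have hΔ : ∀ r ∈ Icc t₀ t, δ r ≤ Δ := fun r hr => le_csSup hbdd (mem_image_of_mem δ hr)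
  have hΔ0 : 0 ≤ Δ := (hg.delta_nonneg t (ht₀.trans ht.1)).trans (hΔ t ⟨ht.1, le_rfl⟩)
  have h1 := hkey hμ (by rw [hμdef]; ring) hx ht₀ ht hΔ
  have h2 := hlow (ht₀.trans ht.1) (x t)
  have h3 := hup ht₀ x₀
  set a := √(K * c₂ / c₁) * Real.exp (-(μ / 2) * (t - t₀)) * ‖x₀‖
  set b := √(K * Real.exp 1) * c₂ / (c₁ * μ) * Δ
  have ha : 0 ≤ a := by positivity
  have hb : 0 ≤ b := by positivity
  have hea : a ^ 2 = K * c₂ / c₁ * Real.exp (-μ * (t - t₀)) * ‖x₀‖ ^ 2 := by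
    have : Real.exp (-(μ / 2) * (t - t₀)) ^ 2 = Real.exp (-μ * (t - t₀)) := by
      rw [← Real.exp_nat_mul]; congr 1; push_cast; ring
    rw [mul_pow, mul_pow, Real.sq_sqrt (by positivity), this]
  have heb : b ^ 2 = K * Real.exp 1 * c₂ ^ 2 / (c₁ * μ) ^ 2 * Δ ^ 2 := by
    rw [mul_pow, div_pow, mul_pow, Real.sq_sqrt (by positivity)]
  have hsq : ‖x t‖ ^ 2 ≤ a ^ 2 + b ^ 2 := by
    rw [← mul_le_mul_iff_right₀ hc₁]
    calc _ ≤ K * (Real.exp (-μ * (t - t₀)) * lyapunovFun κ A t₀ x₀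
          + c₂ ^ 2 * Δ ^ 2 / (c₁ * μ) * Real.exp 1 / μ) := h2.trans h1
      _ ≤ K * (Real.exp (-μ * (t - t₀)) * (c₂ * ‖x₀‖ ^ 2)
          + c₂ ^ 2 * Δ ^ 2 / (c₁ * μ) * Real.exp 1 / μ) := by gcongr
      _ = c₁ * (a ^ 2 + b ^ 2) := by rw [hea, heb]; field_simp
  exact le_of_sq_le_sq (hsq.trans (by nlinarith [mul_nonneg ha hb])) (by positivity)
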